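/- Let $n\ge 2$ be an integer and let $X$ be a nonempty set. An operation $F\colon X^n\to X$ is called *associative* if for all $x_1,\dots,x_{2n-1}\in X$ and all $1\le i\le n-1$ $$F(x_1,\dots,x_{i-1},F(x_i,\dots,x_{i+n-1}),x_{i+n},\dots,x_{2n-1})=F(x_1,\dots,x_i,F(x_{i+1},\dots,x_{i+n}),x_{i+n+1},\dots,x_{2n-1});$$ *quasitrivial* if $F(x_1,\dots,x_n)\in\{x_1,\dots,x_n\}$ always; *symmetric* if it is invariant under all permutations of its arguments. $F$ is *reducible* to an associative operation $G\colon X^2\to X$ if $F=G_{n-1}$, where $G_1=G$ and $G_m(x_1,\dots,x_{m+1})=G_{m-1}(x_1,\dots,x_{m-1},G(x_m,x_{m+1}))$ for $m\ge2$. For a total ordering $\preceq$ on $X$, $F$ is *$\preceq$-preserving* if $F(x_1,\dots,x_n)\preceq F(x_1',\dots,x_n')$ whenever $x_i\preceq x_i'$ for all $i$, and $\max^n_\preceq$ is the $n$-ary maximum operation for $\preceq$. An element $e$ is *neutral* for $F$ if $F(e,\dots,e,x,e,\dots,e)=x$ for all $x\in X$ and every position of $x$. **Theorem.** Let $F\colon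 X^n\to X$ be associative, quasitrivial and symmetric. The following assertions are equivalent: (i) $F$ is reducible to an associative and quasitrivial operation $G\colon X^2\to X$; (ii) there is a total ordering $\preceq$ on $X$ such that $F$ is $\preceq$-preserving; (iii) there is a total ordering $\preceq$ on $X$ such that $F=\max^n_\preceq$. Moreover, if $X=[k]=\{1,\dots,k\}$ with $k\ge1$, each of (i)–(iii) is equivalent to each of the following: (iv) $F$ has exactly one neutral element; (v) the numbers $|F^{-1}[x]|$, $x\in[k]$, listed in nondecreasing order, are $(1,2^n-1,\dots,k^n-(k-1)^n)$. Furthermore, if $X=[k]$ and $F$ is reducible to $G$ as in (i), then there is exactly one total ordering $\preceq$ on $[k]$ with $F=\max^n_\preceq$; it is given by $$x\preceq y\iff|G^{-1}[x]|\le|G^{-1}[y]|\iff|F^{-1}[x]|\le|F^{-1}[y]|,\qquad x,y\in[k],$$ and $F$ is $\preceq$-preserving for this ordering. Finally, for each of the conditions (i)–(v), the number of associative, quasitrivial, symmetric operations $F\colon[k]^n\to[k]$ satisfying it is $k!$. -/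

import Mathlib

namespace NarySemigroup

/-! An `n`-ary operation on `X` is a map `F : (Fin n → X) → X`; its arguments are numbered
`0, …, n - 1`. A total ordering is a relation `r` with `IsLinearOrder X r`. Long
argument strings are read off the beginning of a sequence `x : ℕ → X`. -/

/-- The composite `F (x₀, …, x_{i-1}, F (x_i, …, x_{i+n-1}), x_{i+n}, …, x_{2n-2})`.
For `i < n` only the entries `x₀, …, x_{2n-2}` of the sequence `x` are used. -/
def nested {X : Type*} {n : ℕ} (F : (Fin n → X) → X) (x : ℕ → X) (i : ℕ) : X :=
  F fun j : Fin n =>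
    if (j : ℕ) < i then x j
    else if (j : ℕ) = i then F fun l : Fin n => x (i + l)
    else x (j + (n - 1))

/-- Associativity of an `n`-ary operation: the inner `F` may be shifted by one place. -/
def Associative {X : Type*} {n : ℕ} (F : (Fin n → X) → X) : Prop :=
  ∀ (x : ℕ → X) (i : ℕ), i + 1 < n → nested F x i = nested F x (i + 1)

/-- Every value `F (x₁, …, xₙ)` is one of `x₁, …, xₙ`. -/
def Quasitrivial {X : Type*} {n : ℕ} (F : (Fin n → X) → X) : Prop :=
  ∀ x : Fin n → X, ∃ i : Fin n, F x = x i

/-- Invariance under all permutations of the arguments. -/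
def Symmetric {X : Type*} {n : ℕ} (F : (Fin n → X) → X) : Prop :=
  ∀ (σ : Equiv.Perm (Fin n)) (x : Fin n → X), F (fun i => x (σ i)) = F x

/-- Associativity of a binary operation. -/
def BinAssociative {X : Type*} (G : X → X → X) : Prop :=
  ∀ x y z : X, G (G x y) z = G x (G y z)

/-- Quasitriviality of a binary operation. -/
def BinQuasitrivial {X : Type*} (G : X → X → X) : Prop :=
  ∀ x y : X, G x y = x ∨ G x y = y

/-- The `(m + 1)`-ary operation `G_m` built from a binary operation `G`, applied to `x₀, …, x_m`:
`G_0 (x₀) = x₀` and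
`G_{m+1} (x₀, …, x_{m+1}) = G_m (x₀, …, x_{m-1}, G (x_m, x_{m+1}))`; in particular `G_1 = G`. -/
def iter {X : Type*} (G : X → X → X) : ℕ → (ℕ → X) → X
  | 0, x => x 0
  | m + 1, x => iter G m fun j => if j < m then x j else G (x m) (x (m + 1))

/-- `F` is reducible to the associative binary operation `G`: `F = G_{n-1}`. -/
def ReducibleTo {X : Type*} {n : ℕ} (F : (Fin n → X) → X) (G : X → X → X) : Prop :=
  BinAssociative G ∧ ∀ x : ℕ → X, F (fun i : Fin n => x i) = iter G (n - 1) x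

/-- `F` preserves the relation `r`, that is, it is monotone in all arguments jointly. -/
def Preserves {X : Type*} {n : ℕ} (F : (Fin n → X) → X) (r : X → X → Prop) : Prop :=
  ∀ x y : Fin n → X, (∀ i, r (x i) (y i)) → r (F x) (F y)

/-- `F` is the `n`-ary maximum operation for the (total) ordering `r`. -/
def IsMaximumOp {X : Type*} {n : ℕ} (F : (Fin n → X) → X) (r : X → X → Prop) : Prop :=
  ∀ x : Fin n → X, ∃ i : Fin n, (∀ j, r (x j) (x i)) ∧ F x = x i

/-- `e` is a neutral element: `F (e, …, e, x, e, …, e) = x` for every `x` in every position. -/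
def IsNeutral {X : Type*} {n : ℕ} (F : (Fin n → X) → X) (e : X) : Prop :=
  ∀ (x : X) (i : Fin n), F (Function.update (fun _ => e) i x) = x

/-- `|F⁻¹[y]|`, the number of `n`-tuples sent to `y`. -/
noncomputable def preimageSize {X : Type*} {n : ℕ} (F : (Fin n → X) → X) (y : X) : ℕ :=
  {x : Fin n → X | F x = y}.ncard

/-- `|G⁻¹[y]|` for a binary operation `G`. -/
noncomputable def binPreimageSize {X : Type*} (G : X → X → X) (y : X) : ℕ :=
  {p : X × X | G p.1 p.2 = y}.ncard

/-- The preimage sequence `|F⁻¹|`: the numbers `|F⁻¹[y]|` in nondecreasing order. -/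
noncomputable def preimageSequence {n k : ℕ} (F : (Fin n → Fin k) → Fin k) : List ℕ :=
  (Multiset.map (preimageSize F) (Finset.univ : Finset (Fin k)).val).sort (· ≤ ·)

/-- `F` is reducible to an associative and quasitrivial binary operation. -/
def CondReducible {X : Type*} {n : ℕ} (F : (Fin n → X) → X) : Prop :=
  ∃ G : X → X → X, BinQuasitrivial G ∧ ReducibleTo F G

/-- `F` preserves some total ordering. -/
def CondPreserving {X : Type*} {n : ℕ} (F : (Fin n → X) → X) : Prop :=
  ∃ r : X → X → Prop, IsLinearOrder X r ∧ Preserves F r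

/-- `F` is the maximum operation for some total ordering. -/
def CondMaximum {X : Type*} {n : ℕ} (F : (Fin n → X) → X) : Prop :=
  ∃ r : X → X → Prop, IsLinearOrder X r ∧ IsMaximumOp F r

/-- `F` has exactly one neutral element. -/
def CondNeutral {X : Type*} {n : ℕ} (F : (Fin n → X) → X) : Prop :=
  ∃! e : X, IsNeutral F e

/-- `|F⁻¹| = (1, 2ⁿ - 1, …, kⁿ - (k-1)ⁿ)`; the subtractions are of a smaller number. -/
def CondPreimages {n k : ℕ} (F : (Fin n → Fin k) → Fin k) : Prop :=
  preimageSequence F = List.ofFn fun i : Fin k => ((i : ℕ) + 1) ^ n - (i : ℕ) ^ n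

end NarySemigroup

/-! Write `a ≤ b` when `F (b, a, …, a) = b`. Associativity and symmetry let `F (a, …, a, ·)` pass
through `F` onto any one argument (`pairing_map`). With quasitriviality this makes `≤` a total
preorder in which `F w` is an upper bound of its own arguments, so `F` is always a maximum for `≤`
(`isMaximumOp_pairingRel`). Only antisymmetry can fail, and it holds once `F (b, a, …, a) = F (a, b,
…, b)` for all `a`, `b`. Two distinct equivalent elements must both be neutral
(`pairing_eq_of_equivalent`), so a unique neutral element excludes them; a preserved total order or
a binary reduction also forces this commutation.

Conversely, a total order is recovered from its maximum operation (`IsMaximumOp.eq_pairingRel`). On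
`[k]` the element of rank `e` (from 0) has `(e + 1) ^ n - e ^ n` preimages, which increases strictly
with `e`. Hence preimage sizes determine the order, and the operations correspond to the `k!`
permutations. -/

namespace NarySemigroup

open Function

/-! ### The preorder attached to `F`, and when it is antisymmetric. -/

section Pairing

variable {X : Type*} {n : ℕ} {F : (Fin n → X) → X}

/-- The value `F (b, a, …, a)`. -/
def pairing (F : (Fin n → X) → X) (a b : X) : X :=
  F fun j => if (j : ℕ) = 0 then b else a

theorem Symmetric.map_update_const (hs : Symmetric F) (a b : X) (i : Fin n) :
    F (update (fun _ => a) i b) = pairing F a b := by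
  have hn : 0 < n := i.pos
  rw [pairing, ← hs (Equiv.swap i ⟨0, hn⟩)]
  congr 1
  funext j
  by_cases hj : (j : ℕ) = 0
  · have : j = ⟨0, hn⟩ := Fin.ext hj
    subst this
    simp
  · have hj' : j ≠ ⟨0, hn⟩ := fun h => hj (congrArg Fin.val h)
    rw [if_neg hj]
    by_cases hji : j = i
    · subst hji
      rw [Equiv.swap_apply_left, update_of_ne (Ne.symm hj')]
    · rw [Equiv.swap_apply_of_ne_of_ne hji hj', update_of_ne hji]

theorem Quasitrivial.map_const (hq : Quasitrivial F) (a : X) : F (fun _ => a) = a :=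
  (hq fun _ => a).choose_spec

theorem Quasitrivial.pairing_self (hq : Quasitrivial F) (a : X) : pairing F a a = a := by
  simpa [pairing] using hq.map_const a

theorem Quasitrivial.pairing_eq (hq : Quasitrivial F) (a b : X) :
    pairing F a b = a ∨ pairing F a b = b := by
  obtain ⟨i, hi⟩ := hq fun j => if (j : ℕ) = 0 then b else a
  rw [pairing, hi]
  split_ifs <;> simp

theorem Associative.nested_zero (ha : Associative F) (x : ℕ → X) (i : ℕ) (hi : i < n) :
    nested F x 0 = nested F x i := by
  induction i with
  | zero => rfl
  | succ i ih => rw [ih (by omega), ha x i hi]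

/-- Moving the inner application of `F` across a block of equal arguments. -/
theorem pairing_map (ha : Associative F) (hs : Symmetric F) (a : X) (w : Fin n → X) (i : Fin n) :
    pairing F a (F w) = F (update w i (pairing F a (w i))) := by
  have hn : 0 < n := i.pos
  have key : ∀ v : Fin n → X,
      pairing F a (F v) = F (update v ⟨0, hn⟩ (pairing F a (v ⟨0, hn⟩))) := by
    intro v
    -- The word is `a` repeated `n - 1` times, then `v`. Bracketing at `n - 1` encloses `v`;
    -- bracketing at `0` encloses the `a`s and `v 0`.
    let x : ℕ → X := fun j =>
      if j < n - 1 then a else if h : j - (n - 1) < n then v ⟨j - (n - 1), h⟩ else a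
    have h := ha.nested_zero x (n - 1) (by omega)
    have h1 : nested F x (n - 1) = pairing F a (F v) := by
      rw [← hs.map_update_const a (F v) ⟨n - 1, by omega⟩, nested]
      congr 1
      funext j
      by_cases hj : (j : ℕ) < n - 1
      · rw [if_pos hj, update_of_ne (fun e => by simp [e] at hj)]
        exact if_pos hj
      · have hj' : j = ⟨n - 1, by omega⟩ := Fin.ext (by simp; omega)
        rw [hj']
        simp [x]
    have h2 : nested F x 0 = F (update v ⟨0, hn⟩ (pairing F a (v ⟨0, hn⟩))) := by
      rw [nested]
      congr 1
      funext j
      by_cases hj : (j : ℕ) = 0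
      · have hj' : j = ⟨0, hn⟩ := Fin.ext hj
        subst hj'
        simp only [lt_irrefl, if_false, if_true, update_self]
        rw [← hs.map_update_const a _ ⟨n - 1, by omega⟩]
        congr 1
        funext l
        by_cases hl : (l : ℕ) < n - 1
        · rw [update_of_ne (fun e => by simp [e] at hl)]
          simp [x, hl]
        · have hl' : l = ⟨n - 1, by omega⟩ := Fin.ext (by simp; omega)
          rw [hl']
          simp [x, hn]
      · rw [update_of_ne (fun e => hj (by simp [e]))]
        simp [x, hj]
    rw [← h1, ← h2, h]
  -- Symmetry carries the case of position `0` to position `i`.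
  let σ := Equiv.swap i ⟨0, hn⟩
  have hσ := key fun j => w (σ j)
  rw [hs σ w, ← hs σ (update w i _)] at *
  rw [hσ]
  congr 1
  funext j
  by_cases hj : j = ⟨0, hn⟩
  · subst hj
    simp [σ]
  · have : σ j ≠ i := fun e => hj (by
      rw [← Equiv.swap_apply_self i ⟨0, hn⟩ j]
      exact (congrArg σ e).trans (Equiv.swap_apply_left _ _))
    rw [update_of_ne hj, update_of_ne this]

/-- Absorbing `w i` into slot `i` changes nothing, by idempotence. Thus `F w` is an upper bound of
its arguments. -/
theorem pairing_apply_map (ha : Associative F) (hs : Symmetric F) (hq : Quasitrivial F)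
    (w : Fin n → X) (i : Fin n) : pairing F (w i) (F w) = F w := by
  rw [pairing_map ha hs _ _ i, hq.pairing_self, update_eq_self]

theorem pairing_trans (hn : 2 ≤ n) (ha : Associative F) (hs : Symmetric F) {a b c : X}
    (hab : pairing F a b = b) (hbc : pairing F b c = c) : pairing F a c = c := by
  -- The tuple `(b, c, b, …, b)` has value `c`; absorbing `a` into its first entry `b` leaves it
  -- unchanged.
  have h := pairing_map ha hs a (update (fun _ => b) ⟨1, hn⟩ c) ⟨0, by omega⟩
  have e : update (fun _ => b) (⟨1, hn⟩ : Fin n) c ⟨0, by omega⟩ = b :=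
    update_of_ne (by simp) _ _
  rw [e, hab, hs.map_update_const, hbc] at h
  rw [h]
  nth_rw 2 [← e]
  rw [update_eq_self, hs.map_update_const, hbc]

/-- Both sides evaluate `F (a, …, a, F (b, …, b))`. This is what makes the preorder total. -/
theorem pairing_absorb (hn : 0 < n) (ha : Associative F) (hs : Symmetric F)
    (hq : Quasitrivial F) {a b : X} (h : pairing F a b = a) : pairing F b a = a := by
  have := pairing_map ha hs a (fun _ => b) ⟨0, hn⟩
  rw [hq.map_const, hs.map_update_const, h] at this
  exact this.symm

theorem pairing_total (hn : 0 < n) (ha : Associative F) (hs : Symmetric F)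
    (hq : Quasitrivial F) (a b : X) : pairing F a b = b ∨ pairing F b a = a :=
  (hq.pairing_eq a b).symm.imp_right (pairing_absorb hn ha hs hq)

/-- Two distinct equivalent elements lie below everything. If some `c` were strictly below them,
applying `a` to `F (c, b, …, b)` would give `b` from outside and `F (a, b, …, b) = a` from inside.
-/
theorem pairing_eq_of_equivalent (hn : 2 ≤ n) (ha : Associative F) (hs : Symmetric F)
    (hq : Quasitrivial F) {a b : X} (hab : a ≠ b) (h : pairing F a b = b)
    (h' : pairing F b a = a) (c : X) : pairing F a c = c := by
  by_contra hc
  have hac := (hq.pairing_eq a c).resolve_right hc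
  have hbc := (hq.pairing_eq b c).resolve_right fun e => hc (pairing_trans hn ha hs h e)
  have := pairing_map ha hs a (update (fun _ => b) ⟨0, by omega⟩ c) ⟨0, by omega⟩
  rw [update_self, hac, update_idem, hs.map_update_const, hs.map_update_const, hbc, h, h'] at this
  exact hab this.symm

theorem Symmetric.isNeutral_iff (hn : 0 < n) (hs : Symmetric F) (e : X) :
    IsNeutral F e ↔ ∀ x, pairing F e x = x := by
  simp only [IsNeutral, hs.map_update_const]
  exact ⟨fun h x => h x ⟨0, hn⟩, fun h x _ => h x⟩

theorem pairing_comm_of_neutral (hn : 2 ≤ n) (ha : Associative F) (hs : Symmetric F)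
    (hq : Quasitrivial F) (hu : ∀ d e, IsNeutral F d → IsNeutral F e → d = e) (a b : X) :
    pairing F a b = pairing F b a := by
  by_cases hab : a = b
  · rw [hab]
  rcases hq.pairing_eq a b with h | h
  · rw [h, pairing_absorb (by omega) ha hs hq h]
  rcases hq.pairing_eq b a with h' | h'
  · rw [h, h']
  refine absurd (hu a b ?_ ?_) hab <;> rw [hs.isNeutral_iff (by omega)]
  · exact pairing_eq_of_equivalent hn ha hs hq hab h h'
  · exact pairing_eq_of_equivalent hn ha hs hq (Ne.symm hab) h' h

theorem pairing_comm_of_preserves (hn : 2 ≤ n) (ha : Associative F) (hs : Symmetric F)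
    (hq : Quasitrivial F) {r : X → X → Prop} (hr : IsLinearOrder X r) (hp : Preserves F r)
    (a b : X) : pairing F a b = pairing F b a := by
  have key : ∀ a b, r a b → pairing F a b = b → pairing F b a = a → a = b := by
    intro a b hab h h'
    -- Entrywise `(b, a, a, …, a)` is below `(b, a, b, …, b)`, while the values are `b` and `a`.
    have := hp (update (fun _ => a) ⟨0, by omega⟩ b) (update (fun _ => b) ⟨1, hn⟩ a) ?_
    · rw [hs.map_update_const, hs.map_update_const, h, h'] at this
      exact antisymm_of r hab this
    · intro i
      by_cases h0 : i = ⟨0, by omega⟩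
      · subst h0
        rw [update_self, update_of_ne (by simp)]
        exact refl_of r b
      · rw [update_of_ne h0]
        by_cases h1 : i = ⟨1, hn⟩
        · rw [h1, update_self]
          exact refl_of r a
        · rwa [update_of_ne h1]
  rcases hq.pairing_eq a b with h | h
  · rw [h, pairing_absorb (by omega) ha hs hq h]
  rcases hq.pairing_eq b a with h' | h'
  · rw [h, h']
  rcases total_of r a b with hab | hab
  · rw [key a b hab h h']
  · rw [key b a hab h' h]

/-- The ordering for which `F` is the maximum, if there is one. -/
def pairingRel (F : (Fin n → X) → X) (a b : X) : Prop := pairing F a b = b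

theorem isLinearOrder_pairingRel (hn : 2 ≤ n) (ha : Associative F) (hs : Symmetric F)
    (hq : Quasitrivial F) (hc : ∀ a b, pairing F a b = pairing F b a) :
    IsLinearOrder X (pairingRel F) where
  refl := hq.pairing_self
  trans _ _ _ := pairing_trans hn ha hs
  antisymm a b h h' := by rw [← h', ← hc]; exact h
  total := pairing_total (by omega) ha hs hq

theorem isMaximumOp_pairingRel (ha : Associative F) (hs : Symmetric F) (hq : Quasitrivial F) :
    IsMaximumOp F (pairingRel F) := by
  intro x
  obtain ⟨i, hi⟩ := hq x
  exact ⟨i, fun j => by rw [pairingRel, ← hi]; exact pairing_apply_map ha hs hq x j, hi⟩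

theorem condMaximum_of_pairing_comm (hn : 2 ≤ n) (ha : Associative F) (hs : Symmetric F)
    (hq : Quasitrivial F) (hc : ∀ a b, pairing F a b = pairing F b a) : CondMaximum F :=
  ⟨_, isLinearOrder_pairingRel hn ha hs hq hc, isMaximumOp_pairingRel ha hs hq⟩

end Pairing

/-! ### Maximum operations of a total order. -/

section Maximum

variable {X : Type*} {n : ℕ} {F : (Fin n → X) → X} {r : X → X → Prop}

theorem IsMaximumOp.rel (hm : IsMaximumOp F r) (x : Fin n → X) (j : Fin n) : r (x j) (F x) := by
  obtain ⟨i, hi, e⟩ := hm x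
  rw [e]
  exact hi j

theorem IsMaximumOp.quasitrivial (hm : IsMaximumOp F r) : Quasitrivial F := fun x =>
  (hm x).imp fun _ h => h.2

theorem IsMaximumOp.preserves (hr : IsLinearOrder X r) (hm : IsMaximumOp F r) :
    Preserves F r := by
  intro x y h
  obtain ⟨i, hi⟩ := hm.quasitrivial x
  rw [hi]
  exact trans_of r (h i) (hm.rel y i)

theorem IsMaximumOp.symmetric (hr : IsLinearOrder X r) (hm : IsMaximumOp F r) :
    Symmetric F := by
  intro σ x
  apply antisymm_of r
  · obtain ⟨i, hi⟩ := hm.quasitrivial fun i => x (σ i)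
    rw [hi]
    exact hm.rel x (σ i)
  · obtain ⟨i, hi⟩ := hm.quasitrivial x
    rw [hi]
    simpa using hm.rel (fun i => x (σ i)) (σ.symm i)

theorem IsMaximumOp.rel_nested (hr : IsLinearOrder X r) (hm : IsMaximumOp F r) (x : ℕ → X)
    {i j : ℕ} (hi : i < n) (hj : j < 2 * n - 1) : r (x j) (nested F x i) := by
  have h := hm.rel fun j : Fin n =>
    if (j : ℕ) < i then x j
    else if (j : ℕ) = i then F fun l : Fin n => x (i + l)
    else x (j + (n - 1))
  by_cases h1 : j < i
  · simpa [h1, nested] using h ⟨j, by omega⟩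
  by_cases h2 : j < i + n
  · refine trans_of r ?_ (by simpa [nested] using h ⟨i, hi⟩)
    simpa [Nat.add_sub_cancel' (not_lt.1 h1)] using
      hm.rel (fun l : Fin n => x (i + l)) ⟨j - i, by omega⟩
  · have := h ⟨j - (n - 1), by omega⟩
    simp only at this
    rwa [if_neg (by omega), if_neg (by omega), Nat.sub_add_cancel (by omega)] at this

theorem Quasitrivial.nested_mem (hq : Quasitrivial F) (x : ℕ → X) {i : ℕ} (hi : i < n) :
    ∃ j < 2 * n - 1, nested F x i = x j := by
  obtain ⟨j, hj⟩ := hq fun j : Fin n =>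
    if (j : ℕ) < i then x j
    else if (j : ℕ) = i then F fun l : Fin n => x (i + l)
    else x (j + (n - 1))
  rw [nested, hj]
  obtain ⟨l, hl⟩ := hq fun l : Fin n => x (i + l)
  split_ifs
  · exact ⟨j, by omega, rfl⟩
  · exact ⟨i + l, by omega, hl⟩
  · exact ⟨j + (n - 1), by omega, rfl⟩

/-- Wherever the bracket stands, the value is the maximum of all `2 * n - 1` entries. -/
theorem IsMaximumOp.associative (hr : IsLinearOrder X r) (hm : IsMaximumOp F r) :
    Associative F := by
  have key : ∀ (x : ℕ → X) (i j : ℕ), i < n → j < n → r (nested F x i) (nested F x j) := by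
    intro x i j hi hj
    obtain ⟨l, hl, e⟩ := hm.quasitrivial.nested_mem x hi
    rw [e]
    exact hm.rel_nested hr x hj hl
  intro x i hi
  exact antisymm_of r (key _ _ _ (by omega) hi) (key _ _ _ hi (by omega))

theorem IsMaximumOp.pairing_eq_iff (hn : 2 ≤ n) (hr : IsLinearOrder X r) (hm : IsMaximumOp F r)
    (a b : X) : pairing F a b = b ↔ r a b := by
  have ha : r a (pairing F a b) := by
    simpa [pairing] using hm.rel (fun j => if (j : ℕ) = 0 then b else a) ⟨1, hn⟩
  have hb : r b (pairing F a b) := by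
    simpa [pairing] using hm.rel (fun j => if (j : ℕ) = 0 then b else a) ⟨0, by omega⟩
  refine ⟨fun h => h ▸ ha, fun h => ?_⟩
  rcases hm.quasitrivial.pairing_eq a b with e | e
  · rw [e] at hb ⊢
    exact antisymm_of r h hb
  · exact e

theorem IsMaximumOp.eq_pairingRel (hn : 2 ≤ n) (hr : IsLinearOrder X r) (hm : IsMaximumOp F r) :
    r = pairingRel F := by
  funext a b
  exact propext (hm.pairing_eq_iff hn hr a b).symm

theorem IsMaximumOp.ext (hr : IsLinearOrder X r) (hm : IsMaximumOp F r) {F' : (Fin n → X) → X}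
    (hm' : IsMaximumOp F' r) : F = F' := by
  funext x
  apply antisymm_of r
  · obtain ⟨i, hi⟩ := hm.quasitrivial x
    rw [hi]
    exact hm'.rel x i
  · obtain ⟨i, hi⟩ := hm'.quasitrivial x
    rw [hi]
    exact hm.rel x i

end Maximum

/-! ### Binary reductions, and the implications on an arbitrary set. -/

section Reduction

variable {X : Type*} {n : ℕ} {F : (Fin n → X) → X} {G : X → X → X} {r : X → X → Prop}

theorem BinQuasitrivial.self (hG : BinQuasitrivial G) (a : X) : G a a = a :=
  (hG a a).elim id id

theorem BinQuasitrivial.iter_first (hG : BinQuasitrivial G) (a b : X) (m : ℕ) (x : ℕ → X)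
    (h0 : x 0 = b) (hx : ∀ j ≤ m + 1, j ≠ 0 → x j = a) : iter G (m + 1) x = G b a := by
  induction m generalizing x with
  | zero => simp [iter, h0, hx 1]
  | succ m ih =>
    refine ih _ (by simp [h0]) fun j hj h => ?_
    split_ifs
    · exact hx j (by omega) h
    · rw [hx (m + 1) (by omega) (by omega), hx (m + 1 + 1) le_rfl (by omega), hG.self]

theorem BinQuasitrivial.iter_last (hG : BinQuasitrivial G) (hA : BinAssociative G) (a b : X)
    (m : ℕ) (x : ℕ → X) (h0 : x (m + 1) = b) (hx : ∀ j ≤ m, x j = a) :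
    iter G (m + 1) x = G a b := by
  induction m generalizing x b with
  | zero => simp [iter, h0, hx 0]
  | succ m ih =>
    rw [iter, ih (G a b)]
    · rw [← hA, hG.self]
    · simp [h0, hx (m + 1)]
    · intro j hj
      rw [if_pos (by omega), hx j (by omega)]

theorem ReducibleTo.pairing_eq (hn : 2 ≤ n) (hG : BinQuasitrivial G) (hF : ReducibleTo F G)
    (a b : X) : pairing F a b = G b a := by
  obtain ⟨m, rfl⟩ : ∃ m, n = m + 2 := ⟨n - 2, by omega⟩
  rw [pairing, hF.2 fun j => if j = 0 then b else a]
  exact hG.iter_first a b m _ rfl fun j _ h => if_neg h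

/-- The block of `a`s collapses by idempotence, so `F (b, a, …, a)` is `G b a` and `F (a, …, a, b)`
is `G a b`. -/
theorem ReducibleTo.comm (hn : 2 ≤ n) (hs : Symmetric F) (hG : BinQuasitrivial G)
    (hF : ReducibleTo F G) (a b : X) : G a b = G b a := by
  rw [← hF.pairing_eq hn hG a b]
  obtain ⟨m, rfl⟩ : ∃ m, n = m + 2 := ⟨n - 2, by omega⟩
  rw [← hs.map_update_const a b (Fin.last (m + 1))]
  have h := hF.2 (update (fun _ => a) (m + 1) b)
  rw [show m + 2 - 1 = m + 1 from rfl, hG.iter_last hF.1 a b m _ (update_self ..)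
    fun j hj => update_of_ne (by omega) _ _] at h
  rw [← h]
  congr 1
  funext j
  simp [update_apply, Fin.ext_iff]

theorem condMaximum_of_reducible (hn : 2 ≤ n) (ha : Associative F) (hs : Symmetric F)
    (hq : Quasitrivial F) (h : CondReducible F) : CondMaximum F := by
  obtain ⟨G, hG, hF⟩ := h
  refine condMaximum_of_pairing_comm hn ha hs hq fun a b => ?_
  rw [hF.pairing_eq hn hG, hF.pairing_eq hn hG, hF.comm hn hs hG]

open Classical in
/-- The binary maximum for the relation `r`. -/
noncomputable def binMax (r : X → X → Prop) (a b : X) : X := if r a b then b else a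

theorem binMax_quasitrivial (r : X → X → Prop) : BinQuasitrivial (binMax r) := by
  intro a b
  rw [binMax]
  split_ifs <;> simp

theorem rel_binMax_left (hr : IsLinearOrder X r) (a b : X) : r a (binMax r a b) := by
  rw [binMax]
  split_ifs with h
  exacts [h, refl_of r a]

theorem rel_binMax_right (hr : IsLinearOrder X r) (a b : X) : r b (binMax r a b) := by
  rw [binMax]
  split_ifs with h
  exacts [refl_of r b, (total_of r a b).resolve_left h]

theorem binMax_rel {a b c : X} (ha : r a c) (hb : r b c) : r (binMax r a b) c := by
  rcases binMax_quasitrivial r a b with h | h <;> rwa [h]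

theorem binMax_associative (hr : IsLinearOrder X r) : BinAssociative (binMax r) := by
  intro a b c
  have l := rel_binMax_left hr
  have u := rel_binMax_right hr
  apply antisymm_of r
  · exact binMax_rel (binMax_rel (l _ _) (trans_of r (l b c) (u _ _)))
      (trans_of r (u b c) (u _ _))
  · exact binMax_rel (trans_of r (l a b) (l _ _))
      (binMax_rel (trans_of r (u a b) (l _ _)) (u _ _))

theorem rel_iter_binMax (hr : IsLinearOrder X r) (m : ℕ) (x : ℕ → X) (j : ℕ) (hj : j ≤ m) :
    r (x j) (iter (binMax r) m x) := by
  induction m generalizing x j with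
  | zero =>
    obtain rfl : j = 0 := by omega
    exact refl_of r _
  | succ m ih =>
    have h := ih fun j => if j < m then x j else binMax r (x m) (x (m + 1))
    rcases Nat.lt_or_ge j m with hjm | hjm
    · simpa [iter, hjm] using h j hjm.le
    · refine trans_of r ?_ (by simpa [iter] using h m le_rfl)
      rcases Nat.eq_or_lt_of_le hjm with rfl | hjm
      · exact rel_binMax_left hr _ _
      · obtain rfl : j = m + 1 := by omega
        exact rel_binMax_right hr _ _

theorem BinQuasitrivial.iter_mem (hG : BinQuasitrivial G) (m : ℕ) (x : ℕ → X) :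
    ∃ j ≤ m, iter G m x = x j := by
  induction m generalizing x with
  | zero => exact ⟨0, le_rfl, rfl⟩
  | succ m ih =>
    obtain ⟨j, hj, e⟩ := ih fun j => if j < m then x j else G (x m) (x (m + 1))
    rw [iter, e]
    split_ifs
    · exact ⟨j, by omega, rfl⟩
    · rcases hG (x m) (x (m + 1)) with h | h
      · exact ⟨m, by omega, h⟩
      · exact ⟨m + 1, le_rfl, h⟩

theorem IsMaximumOp.reducibleTo_binMax (hn : 0 < n) (hr : IsLinearOrder X r)
    (hm : IsMaximumOp F r) : ReducibleTo F (binMax r) := by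
  refine ⟨binMax_associative hr, fun x => antisymm_of r ?_ ?_⟩
  · obtain ⟨i, hi⟩ := hm.quasitrivial fun i => x i
    rw [hi]
    exact rel_iter_binMax hr _ x i (by omega)
  · obtain ⟨j, hj, e⟩ := (binMax_quasitrivial r).iter_mem (n - 1) x
    rw [e]
    exact hm.rel (fun i : Fin n => x i) ⟨j, by omega⟩

theorem CondMaximum.condReducible (hn : 0 < n) (h : CondMaximum F) : CondReducible F := by
  obtain ⟨r, hr, hm⟩ := h
  exact ⟨_, binMax_quasitrivial r, hm.reducibleTo_binMax hn hr⟩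

theorem CondMaximum.condPreserving (h : CondMaximum F) : CondPreserving F := by
  obtain ⟨r, hr, hm⟩ := h
  exact ⟨r, hr, hm.preserves hr⟩

theorem condMaximum_of_preserving (hn : 2 ≤ n) (ha : Associative F) (hs : Symmetric F)
    (hq : Quasitrivial F) (h : CondPreserving F) : CondMaximum F := by
  obtain ⟨r, hr, hp⟩ := h
  exact condMaximum_of_pairing_comm hn ha hs hq (pairing_comm_of_preserves hn ha hs hq hr hp)

theorem condMaximum_of_neutral (hn : 2 ≤ n) (ha : Associative F) (hs : Symmetric F)
    (hq : Quasitrivial F) (h : CondNeutral F) : CondMaximum F :=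
  condMaximum_of_pairing_comm hn ha hs hq
    (pairing_comm_of_neutral hn ha hs hq fun _ _ => h.unique)

end Reduction
-- Preimage sizes, neutral elements and counting on `[k]`.
section Finite

variable {n k : ℕ} {F : (Fin n → Fin k) → Fin k} {r : Fin k → Fin k → Prop}

theorem strictMono_succ_pow_sub_pow (hn : 2 ≤ n) :
    StrictMono fun e : ℕ => (e + 1) ^ n - e ^ n := by
  refine strictMono_nat_of_lt_succ fun e => ?_
  -- Strict convexity of the `n`-th power, stated without subtraction.
  have key : 2 * (e + 1) ^ n < (e + 2) ^ n + e ^ n := by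
    induction n, hn using Nat.le_induction with
    | base => nlinarith
    | succ n _ ih =>
      have h : e ^ n ≤ (e + 2) ^ n := Nat.pow_le_pow_left (by omega) n
      rw [pow_succ, pow_succ, pow_succ]
      nlinarith
  have h₁ : e ^ n ≤ (e + 1) ^ n := Nat.pow_le_pow_left (by omega) n
  change _ < (e + 2) ^ n - (e + 1) ^ n
  omega

theorem exists_perm_rel_iff (hr : IsLinearOrder (Fin k) r) :
    ∃ σ : Equiv.Perm (Fin k), ∀ x y, r x y ↔ σ x ≤ σ y := by
  classical
  -- The permutation sends each element to its rank, the number of elements strictly below it.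
  let below (y : Fin k) : Finset (Fin k) := {x | r x y ∧ x ≠ y}
  have hlt : ∀ y, (below y).card < k := fun y => by
    have : below y ⊂ Finset.univ := Finset.ssubset_univ_iff.2 fun h => by
      have hy : y ∈ below y := h ▸ Finset.mem_univ y
      simp [below] at hy
    simpa using Finset.card_lt_card this
  have hmono : ∀ x y, r x y → x ≠ y → (below x).card < (below y).card := by
    intro x y hxy hne
    refine Finset.card_lt_card (Finset.ssubset_iff_of_subset ?_ |>.2 ⟨x, ?_, ?_⟩)
    · intro z hz
      simp only [below, Finset.mem_filter, Finset.mem_univ, true_and] at hz ⊢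
      refine ⟨trans_of r hz.1 hxy, ?_⟩
      rintro rfl
      exact hne (antisymm_of r hxy hz.1)
    · simp [below, hxy, hne]
    · simp [below]
  let f (y : Fin k) : Fin k := ⟨(below y).card, hlt y⟩
  have hf : Injective f := by
    intro x y h
    by_contra hne
    have h' : (below x).card = (below y).card := congrArg Fin.val h
    rcases total_of r x y with hxy | hxy
    · exact (hmono x y hxy hne).ne h'
    · exact (hmono y x hxy (Ne.symm hne)).ne' h'
  refine ⟨Equiv.ofBijective f (Finite.injective_iff_bijective.1 hf), fun x y => ?_⟩
  change r x y ↔ (below x).card ≤ (below y).card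
  by_cases hne : x = y
  · subst hne
    exact iff_of_true (refl_of r x) le_rfl
  · refine ⟨fun h => (hmono x y h hne).le, fun h => ?_⟩
    by_contra hxy
    have := hmono y x ((total_of r x y).resolve_left hxy) (Ne.symm hne)
    omega

theorem isLinearOrder_perm (σ : Equiv.Perm (Fin k)) :
    IsLinearOrder (Fin k) fun x y => σ x ≤ σ y where
  refl _ := le_rfl
  trans _ _ _ := le_trans
  antisymm _ _ h h' := σ.injective (le_antisymm h h')
  total _ _ := le_total _ _

theorem exists_isMaximumOp_perm (hn : 0 < n) (σ : Equiv.Perm (Fin k)) :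
    ∃ F : (Fin n → Fin k) → Fin k, IsMaximumOp F fun x y => σ x ≤ σ y := by
  have : Nonempty (Fin n) := ⟨⟨0, hn⟩⟩
  have h := fun x : Fin n → Fin k => Finite.exists_max fun i => σ (x i)
  choose i hi using h
  exact ⟨fun x => x (i x), fun x => ⟨i x, hi x, rfl⟩⟩

theorem preimageSize_eq {σ : Equiv.Perm (Fin k)} (hm : IsMaximumOp F fun x y => σ x ≤ σ y)
    (y : Fin k) : preimageSize F y = ((σ y : ℕ) + 1) ^ n - (σ y : ℕ) ^ n := by
  classical
  have hle : (Finset.univ.filter fun x => σ x ≤ σ y).card = (σ y : ℕ) + 1 := by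
    rw [← Fin.card_Iic (σ y)]
    exact Finset.card_equiv σ (by simp)
  have hlt : (Finset.univ.filter fun x => σ x < σ y).card = (σ y : ℕ) := by
    rw [← Fin.card_Iio (σ y)]
    exact Finset.card_equiv σ (by simp)
  -- The maximum is `y` exactly when all entries are at most `y` and not all are strictly below: a
  -- difference of two boxes.
  have hset : {x : Fin n → Fin k | F x = y} =
      ((Fintype.piFinset fun _ => Finset.univ.filter fun x => σ x ≤ σ y) \
        (Fintype.piFinset fun _ => Finset.univ.filter fun x => σ x < σ y) :
          Finset (Fin n → Fin k)) := by
    ext x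
    simp only [Set.mem_ofPred_eq, Finset.coe_sdiff, Set.mem_sdiff, Finset.mem_coe,
      Fintype.mem_piFinset, Finset.mem_filter, Finset.mem_univ, true_and, not_forall, not_lt]
    constructor
    · rintro rfl
      refine ⟨hm.rel x, ?_⟩
      obtain ⟨i, hi⟩ := hm.quasitrivial x
      exact ⟨i, by rw [← hi]⟩
    · rintro ⟨h, i, hi⟩
      obtain ⟨j, hj⟩ := hm.quasitrivial x
      apply σ.injective
      apply le_antisymm
      · rw [hj]
        exact h j
      · exact hi.trans (hm.rel x i)
  rw [preimageSize, hset, Set.ncard_coe_finset, Finset.card_sdiff_of_subset,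
    Fintype.card_piFinset_const, Fintype.card_piFinset_const, hle, hlt]
  · exact Fintype.piFinset_subset _ _ fun _ => Finset.monotone_filter_right _ fun _ _ h => h.le

theorem IsMaximumOp.preimageSize_le_iff (hn : 2 ≤ n) (hr : IsLinearOrder (Fin k) r)
    (hm : IsMaximumOp F r) (x y : Fin k) : preimageSize F x ≤ preimageSize F y ↔ r x y := by
  obtain ⟨σ, hσ⟩ := exists_perm_rel_iff hr
  obtain rfl : r = fun x y => σ x ≤ σ y := by
    funext x y
    exact propext (hσ x y)
  rw [preimageSize_eq hm, preimageSize_eq hm]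
  exact (strictMono_succ_pow_sub_pow hn).le_iff_le

theorem CondMaximum.condPreimages (hn : 2 ≤ n) (h : CondMaximum F) : CondPreimages F := by
  obtain ⟨r, hr, hm⟩ := h
  obtain ⟨σ, hσ⟩ := exists_perm_rel_iff hr
  obtain rfl : r = fun x y => σ x ≤ σ y := by
    funext x y
    exact propext (hσ x y)
  let f (i : Fin k) : ℕ := ((i : ℕ) + 1) ^ n - (i : ℕ) ^ n
  have hF : preimageSize F = f ∘ σ := funext fun y => preimageSize_eq hm y
  have hmap : Multiset.map (preimageSize F) (Finset.univ : Finset (Fin k)).val =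
      (List.ofFn f : Multiset ℕ) := by
    rw [hF, ← Multiset.map_map]
    have : Multiset.map σ (Finset.univ : Finset (Fin k)).val = Finset.univ.val := by
      exact congrArg Finset.val (Finset.map_univ_equiv σ)
    rw [this, Fin.univ_val_map]
  rw [CondPreimages, preimageSequence, hmap]
  refine List.Perm.eq_of_pairwise' (Multiset.pairwise_sort _ _) ?_
    (Multiset.coe_eq_coe.1 (Multiset.sort_eq _ _))
  exact List.pairwise_ofFn.2 fun i j h => ((strictMono_succ_pow_sub_pow hn) h).le

theorem CondMaximum.condNeutral (hn : 2 ≤ n) (hk : 1 ≤ k) (hs : Symmetric F)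
    (h : CondMaximum F) : CondNeutral F := by
  obtain ⟨r, hr, hm⟩ := h
  obtain ⟨σ, hσ⟩ := exists_perm_rel_iff hr
  have hN : ∀ e, IsNeutral F e ↔ ∀ x, σ e ≤ σ x := fun e => by
    simp only [hs.isNeutral_iff (by omega), hm.pairing_eq_iff hn hr, hσ]
  refine ⟨σ.symm ⟨0, hk⟩, (hN _).2 fun x => ?_, fun d hd => ?_⟩
  · rw [Equiv.apply_symm_apply]
    exact Nat.zero_le _
  · apply σ.injective
    apply le_antisymm ((hN d).1 hd _)
    rw [Equiv.apply_symm_apply]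
    exact Nat.zero_le _

/-- Some `e` has only the constant tuple as preimage. So `F (x, e, …, e)` is `e` only for `x = e`,
and otherwise is `x` by quasitriviality. A neutral `d` gives `F (e, d, …, d) = e`, whence `d = e`.
-/
theorem CondPreimages.condNeutral (hn : 2 ≤ n) (hk : 1 ≤ k) (hs : Symmetric F)
    (hq : Quasitrivial F) (h : CondPreimages F) : CondNeutral F := by
  have h1 : 1 ∈ preimageSequence F := by
    rw [h, List.mem_ofFn]
    exact ⟨⟨0, hk⟩, by simp [show n ≠ 0 by omega]⟩
  rw [preimageSequence, Multiset.mem_sort, Multiset.mem_map] at h1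
  obtain ⟨e, -, he⟩ := h1
  obtain ⟨a, hae⟩ := Set.ncard_eq_one.1 he
  have huniq : ∀ x, F x = e → x = fun _ => e := by
    intro x hx
    have hx' : x ∈ ({a} : Set (Fin n → Fin k)) := hae ▸ hx
    have hc : (fun _ => e) ∈ ({a} : Set (Fin n → Fin k)) := hae ▸ hq.map_const e
    rw [Set.mem_singleton_iff.1 hx', Set.mem_singleton_iff.1 hc]
  refine ⟨e, (hs.isNeutral_iff (by omega) e).2 fun x => ?_, fun d hd => ?_⟩
  · rcases hq.pairing_eq e x with hx | hx
    · have := congrFun (huniq _ hx) ⟨0, by omega⟩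
      rw [if_pos rfl] at this
      rw [hx, this]
    · exact hx
  · have := congrFun (huniq _ ((hs.isNeutral_iff (by omega) d).1 hd e)) ⟨1, hn⟩
    simpa using this

/-- Viewing `G` as an operation of arity 2 with the same order makes the preimage count for maxima
apply to it too. -/
theorem isMaximumOp_binary {X : Type*} {F : (Fin n → X) → X} {G : X → X → X} (hn : 2 ≤ n)
    (hs : Symmetric F) (hG : BinQuasitrivial G) (hF : ReducibleTo F G) :
    IsMaximumOp (fun v : Fin 2 → X => G (v 0) (v 1)) (pairingRel F) := by
  intro v
  have hp : ∀ a b, pairingRel F a b ↔ G a b = b := fun a b => by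
    rw [pairingRel, hF.pairing_eq hn hG, hF.comm hn hs hG]
  simp only [hp, Fin.exists_fin_two, Fin.forall_fin_two, hG.self, true_and, and_true]
  rw [hF.comm hn hs hG (v 1) (v 0)]
  rcases hG (v 0) (v 1) with h | h
  · exact Or.inl ⟨h, h⟩
  · exact Or.inr ⟨h, h⟩

theorem binPreimageSize_eq {X : Type*} (G : X → X → X) (y : X) :
    binPreimageSize G y = preimageSize (fun v : Fin 2 → X => G (v 0) (v 1)) y := by
  rw [binPreimageSize, preimageSize, ← Set.ncard_image_of_injective _ (finTwoArrowEquiv X).injective]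
  congr 1
  ext ⟨a, b⟩
  simp only [Set.mem_ofPred_eq, Equiv.image_eq_preimage_symm, Set.mem_preimage]
  rfl

theorem tfae_conditions (hn : 2 ≤ n) {X : Type*} {F : (Fin n → X) → X} (ha : Associative F)
    (hq : Quasitrivial F) (hs : Symmetric F) :
    List.TFAE [CondReducible F, CondPreserving F, CondMaximum F] := by
  tfae_have 1 → 3 := condMaximum_of_reducible hn ha hs hq
  tfae_have 2 → 3 := condMaximum_of_preserving hn ha hs hq
  tfae_have 3 → 1 := CondMaximum.condReducible (by omega)
  tfae_have 3 → 2 := CondMaximum.condPreserving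
  tfae_finish

theorem tfae_conditions_finite (hn : 2 ≤ n) (hk : 1 ≤ k) (ha : Associative F)
    (hq : Quasitrivial F) (hs : Symmetric F) :
    List.TFAE [CondReducible F, CondPreserving F, CondMaximum F, CondNeutral F,
      CondPreimages F] := by
  tfae_have 1 → 3 := condMaximum_of_reducible hn ha hs hq
  tfae_have 2 → 3 := condMaximum_of_preserving hn ha hs hq
  tfae_have 3 → 1 := CondMaximum.condReducible (by omega)
  tfae_have 3 → 2 := CondMaximum.condPreserving
  tfae_have 4 → 3 := condMaximum_of_neutral hn ha hs hq
  tfae_have 3 → 5 := CondMaximum.condPreimages hn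
  tfae_have 5 → 4 := CondPreimages.condNeutral hn hk hs hq
  tfae_finish

theorem binPreimageSize_le_iff (hn : 2 ≤ n) {G : Fin k → Fin k → Fin k} (ha : Associative F)
    (hq : Quasitrivial F) (hs : Symmetric F) (hG : BinQuasitrivial G) (hF : ReducibleTo F G)
    (x y : Fin k) : binPreimageSize G x ≤ binPreimageSize G y ↔ pairingRel F x y := by
  have hr := isLinearOrder_pairingRel hn ha hs hq fun a b => by
    rw [hF.pairing_eq hn hG, hF.pairing_eq hn hG, hF.comm hn hs hG]
  rw [binPreimageSize_eq, binPreimageSize_eq]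
  exact (isMaximumOp_binary hn hs hG hF).preimageSize_le_iff le_rfl hr x y

/-- The composite of `σ⁻¹` and `τ` is an order automorphism of a finite chain, hence the identity.
-/
theorem perm_eq_of_le_iff {σ τ : Equiv.Perm (Fin k)} (h : ∀ x y, σ x ≤ σ y ↔ τ x ≤ τ y) :
    σ = τ := by
  let e : Fin k ≃o Fin k := ⟨σ.symm.trans τ, fun {a b} => by
    simpa using (h (σ.symm a) (σ.symm b)).symm⟩
  have he : e = OrderIso.refl _ := Subsingleton.elim _ _
  ext x
  have := congrArg (fun f : Fin k ≃o Fin k => f (σ x)) he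
  simpa [e] using congrArg Fin.val this.symm

theorem ncard_condMaximum (hn : 2 ≤ n) :
    {F : (Fin n → Fin k) → Fin k | CondMaximum F}.ncard = k.factorial := by
  choose f hf using exists_isMaximumOp_perm (k := k) (show 0 < n by omega)
  have hinj : Injective f := by
    intro σ τ h
    apply perm_eq_of_le_iff
    intro x y
    rw [← (hf σ).pairing_eq_iff hn (isLinearOrder_perm σ), h,
      (hf τ).pairing_eq_iff hn (isLinearOrder_perm τ)]
  have hrange : {F : (Fin n → Fin k) → Fin k | CondMaximum F} = Set.range f := by
    ext F
    constructor
    · rintro ⟨r, hr, hm⟩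
      obtain ⟨σ, hσ⟩ := exists_perm_rel_iff hr
      obtain rfl : r = fun x y => σ x ≤ σ y := by
        funext x y
        exact propext (hσ x y)
      exact ⟨σ, (hf σ).ext hr hm⟩
    · rintro ⟨σ, rfl⟩
      exact ⟨_, isLinearOrder_perm σ, hf σ⟩
  rw [hrange, ← Set.image_univ, Set.ncard_image_of_injective _ hinj, Set.ncard_univ,
    Nat.card_perm, Nat.card_fin]

theorem ncard_of_iff_condMaximum (hn : 2 ≤ n) {P : ((Fin n → Fin k) → Fin k) → Prop}
    (hP : ∀ F, Associative F → Quasitrivial F → Symmetric F → (P F ↔ CondMaximum F)) :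
    {F : (Fin n → Fin k) → Fin k |
      Associative F ∧ Quasitrivial F ∧ Symmetric F ∧ P F}.ncard = k.factorial := by
  rw [← ncard_condMaximum hn]
  congr 1
  ext F
  constructor
  · rintro ⟨ha, hq, hs, h⟩
    exact (hP F ha hq hs).1 h
  · rintro ⟨r, hr, hm⟩
    have ha := hm.associative hr
    have hs := hm.symmetric hr
    exact ⟨ha, hm.quasitrivial, hs, (hP F ha hm.quasitrivial hs).2 ⟨r, hr, hm⟩⟩

end Finite
end NarySemigroup

theorem theorem4p5 (n : ℕ) (hn : 2 ≤ n) :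
    -- the equivalences on an arbitrary nonempty set
    (∀ (X : Type*) [Nonempty X] (F : (Fin n → X) → X),
      NarySemigroup.Associative F → NarySemigroup.Quasitrivial F → NarySemigroup.Symmetric F →
      List.TFAE [NarySemigroup.CondReducible F, NarySemigroup.CondPreserving F,
        NarySemigroup.CondMaximum F]) ∧
    -- the finite case `X = [k]`
    (∀ k : ℕ, 1 ≤ k →
      (∀ F : (Fin n → Fin k) → Fin k,
        NarySemigroup.Associative F → NarySemigroup.Quasitrivial F → NarySemigroup.Symmetric F →
        List.TFAE [NarySemigroup.CondReducible F, NarySemigroup.CondPreserving F,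
          NarySemigroup.CondMaximum F, NarySemigroup.CondNeutral F,
          NarySemigroup.CondPreimages F] ∧
        -- for every associative and quasitrivial binary reduction `G` of `F`:
        (∀ G : Fin k → Fin k → Fin k,
          NarySemigroup.BinQuasitrivial G → NarySemigroup.ReducibleTo F G →
          -- `r` is a total ordering with `F = max` for `r` exactly if `r` compares the `|G⁻¹[x]|`
          (∀ r : Fin k → Fin k → Prop,
            (IsLinearOrder (Fin k) r ∧ NarySemigroup.IsMaximumOp F r) ↔
              ∀ x y, r x y ↔
                NarySemigroup.binPreimageSize G x ≤ NarySemigroup.binPreimageSize G y) ∧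
          -- `F` preserves this ordering
          NarySemigroup.Preserves F (fun x y =>
            NarySemigroup.binPreimageSize G x ≤ NarySemigroup.binPreimageSize G y) ∧
          -- the preimage sizes of `F` give the same ordering
          (∀ x y, NarySemigroup.binPreimageSize G x ≤ NarySemigroup.binPreimageSize G y ↔
            NarySemigroup.preimageSize F x ≤ NarySemigroup.preimageSize F y))) ∧
      -- there are `k!` operations satisfying any given one of the five conditions
      (∀ P ∈ ([NarySemigroup.CondReducible, NarySemigroup.CondPreserving,
            NarySemigroup.CondMaximum, NarySemigroup.CondNeutral, NarySemigroup.CondPreimages] :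
            List (((Fin n → Fin k) → Fin k) → Prop)),
        {F : (Fin n → Fin k) → Fin k |
          NarySemigroup.Associative F ∧ NarySemigroup.Quasitrivial F ∧
            NarySemigroup.Symmetric F ∧ P F}.ncard = k.factorial)) := by
  open NarySemigroup in
  refine ⟨fun X _ F ha hq hs => tfae_conditions hn ha hq hs, fun k hk => ⟨fun F ha hq hs =>
    ⟨tfae_conditions_finite hn hk ha hq hs, fun G hG hF => ?_⟩, fun P hP => ?_⟩⟩
  · have hr := isLinearOrder_pairingRel hn ha hs hq fun a b => by
      rw [hF.pairing_eq hn hG, hF.pairing_eq hn hG, hF.comm hn hs hG]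
    have hm := isMaximumOp_pairingRel ha hs hq
    have hle := binPreimageSize_le_iff hn ha hq hs hG hF
    -- Both comparisons of sizes become `pairingRel F`, which settles the last clause.
    simp only [hle, hm.preimageSize_le_iff hn hr, implies_true, and_true]
    refine ⟨fun r => ⟨?_, fun h => ?_⟩, hm.preserves hr⟩
    · rintro ⟨hr', hm'⟩ x y
      rw [hm'.eq_pairingRel hn hr']
    · obtain rfl : r = pairingRel F := by
        funext x y
        exact propext (h x y)
      exact ⟨hr, hm⟩
  · refine ncard_of_iff_condMaximum hn fun F ha hq hs => ?_
    have h := tfae_conditions_finite hn hk ha hq hs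
    simp only [List.mem_cons, List.not_mem_nil, or_false] at hP
    rcases hP with rfl | rfl | rfl | rfl | rfl
    exacts [h.out 0 2, h.out 1 2, Iff.rfl, h.out 3 2, h.out 4 2]
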